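/- Let $0<c_0\le C_0$ and $C_1>0$ be fixed constants. Then there is a constant $C_2>0$, depending only on $c_0,C_0,C_1$, such that the following holds. Let $n\ge 1$, $r\ge 1$ and $p\ge 2r$ be integers and let $\lambda,\sigma>0$ satisfy $$n\ge C_1\,(r\log n+\log^2 n),\qquad \frac{\lambda}{\sigma^2}\ge C_1\Big(\frac pn+\sqrt{\frac pn}\Big).$$ Let $\Sigma=U\Lambda U^\top+\sigma^2 I_p$ be a spiked covariance matrix, where $U\in\mathbb R^{p\times r}$ satisfies $U^\top U=I_r$ and $\Lambda=\mathrm{diag}(\lambda_1,\dots,\lambda_r)$ with $C_0\lambda\ge\lambda_1\ge\dots\ge\lambda_r\ge c_0\lambda$. Let $X_1,\dots,X_n$ be i.i.d. $\mathcal N(0,\Sigma)$ random vectors in $\mathbb R^p$ and, for each $i\in[n]$, let $X_i'\sim\mathcal N(0,\Sigma)$ be independent of $(X_1,\dots,X_n)$. Put $$\widehat\Sigma=\frac1n\sum_{j=1}^n X_jX_j^\top,\qquad \widehat\Sigma^{(i)}=\frac1n\Big(X_i'X_i'^\top+\sum_{j\ne i}X_jX_j^\top\Big),$$ and let $\lambda_k(A)$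 denote the $k$-th largest eigenvalue (with multiplicity) of a symmetric matrix $A$. Then, with probability at least $1-n^{-100}$, simultaneously for all $i\in[n]$, $$\sum_{k=1}^p\big(\lambda_k(\widehat\Sigma)-\lambda_k(\widehat\Sigma^{(i)})\big)^2\le C_2\left(\frac{\lambda(r+\log n)+\sigma^2(p+\log n)}{n}\right)^2 .$$ -/

import Mathlib

open MeasureTheory ProbabilityTheory

/-- The parameter space `Θ(p, r, lam, sigma2)` of spiked covariance matrices
`U * diag(ℓ₁, …, ℓᵣ) * Uᵀ + sigma2 * I` with `Uᵀ * U = I`, `ℓ₁ ≥ … ≥ ℓᵣ`, and all spikes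
between `c₀ * lam` and `C₀ * lam`. -/
def spikedCovariances (c₀ C₀ : ℝ) (p r : ℕ) (lam sigma2 : ℝ) :
    Set (Matrix (Fin p) (Fin p) ℝ) :=
  {S | ∃ (U : Matrix (Fin p) (Fin r) ℝ) (ℓ : Fin r → ℝ),
    U.transpose * U = 1 ∧ Antitone ℓ ∧ (∀ k, c₀ * lam ≤ ℓ k ∧ ℓ k ≤ C₀ * lam) ∧
    S = U * Matrix.diagonal ℓ * U.transpose + sigma2 • (1 : Matrix (Fin p) (Fin p) ℝ)}

/-- The (uncentered) sample covariance matrix `n⁻¹ ∑ᵢ xᵢ xᵢᵀ`. -/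
noncomputable def sampleCov {n p : ℕ} (x : Fin n → EuclideanSpace ℝ (Fin p)) :
    Matrix (Fin p) (Fin p) ℝ :=
  (n : ℝ)⁻¹ • ∑ i, Matrix.vecMulVec (x i).ofLp (x i).ofLp

theorem sampleCov_isHermitian {n p : ℕ} (x : Fin n → EuclideanSpace ℝ (Fin p)) :
    (sampleCov x).IsHermitian := by
  ext a b
  simp [sampleCov, Matrix.sum_apply, Matrix.vecMulVec_apply, mul_comm]

/-- The eigenvalues of a real symmetric matrix, counted with multiplicity and listed in
decreasing order: `sortedEigenvalue hA k` is the `(k+1)`-st largest one. -/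
noncomputable def sortedEigenvalue {p : ℕ} {A : Matrix (Fin p) (Fin p) ℝ}
    (hA : A.IsHermitian) (k : Fin p) : ℝ :=
  hA.eigenvalues₀ (Fin.cast (Fintype.card_fin p).symm k)

/-- The data set obtained from `x` by replacing the `i`-th observation by `y`. -/
def replaceObs {n p : ℕ} (x : Fin n → EuclideanSpace ℝ (Fin p)) (i : Fin n)
    (y : EuclideanSpace ℝ (Fin p)) : Fin n → EuclideanSpace ℝ (Fin p) :=
  Function.update x i y

/-! By `hoffman_wielandt`, the eigenvalue sum is at most the squared Frobenius norm of the
difference of the two sample covariances. That difference is `n⁻¹ (x xᵀ - y yᵀ)`, with `x` the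
removed and `y` the inserted observation, so its norm is at most `(‖x‖² + ‖y‖²) / n`, which is
deterministic. It remains to bound all the norms at once. Writing an observation as `S^{1/2} z` with
`z` standard Gaussian gives `‖x‖² ≤ C₀ λ ‖Uᵀz‖² + σ² ‖z‖²`. Since `Uᵀz` is standard Gaussian in
dimension `r`, two chi-square tails and a union bound over the `2n` vectors conclude. -/

/-! ### The Hoffman–Wielandt inequality -/

/-- Birkhoff's theorem reduces to permutation matrices, where this is the rearrangement inequality.
-/
theorem sum_mul_mul_le_of_mem_doublyStochastic {n : Type*} [Fintype n] [DecidableEq n]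
    {a b : n → ℝ} (hab : Monovary a b) {M : Matrix n n ℝ} (hM : M ∈ doublyStochastic ℝ n) :
    ∑ i, ∑ j, a i * M i j * b j ≤ ∑ i, a i * b i := by
  obtain ⟨w, hw0, hw1, rfl⟩ := exists_eq_sum_perm_of_mem_doublyStochastic hM
  have key (i : n) : ∑ j, a i * (∑ τ : Equiv.Perm n, w τ • τ.permMatrix ℝ) i j * b j
      = ∑ τ : Equiv.Perm n, w τ * (a i * b (τ i)) := by
    simp only [Matrix.sum_apply, Matrix.smul_apply, smul_eq_mul, Finset.mul_sum, Finset.sum_mul,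
      Equiv.Perm.permMatrix, PEquiv.toMatrix_apply, Equiv.toPEquiv_apply, Option.mem_some_iff]
    rw [Finset.sum_comm]
    refine Finset.sum_congr rfl fun τ _ => ?_
    rw [Finset.sum_eq_single (τ i)]
    · simp; ring
    · intro j _ hj
      simp [Ne.symm hj]
    · simp
  simp_rw [key]
  rw [Finset.sum_comm]
  calc ∑ τ : Equiv.Perm n, ∑ i, w τ * (a i * b (τ i))
      ≤ ∑ τ : Equiv.Perm n, w τ * ∑ i, a i * b i := by
        refine Finset.sum_le_sum fun τ _ => ?_
        rw [← Finset.mul_sum]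
        exact mul_le_mul_of_nonneg_left hab.sum_mul_comp_perm_le_sum_mul (hw0 τ)
    _ = ∑ i, a i * b i := by rw [← Finset.sum_mul, hw1, one_mul]

theorem sq_entries_mem_doublyStochastic {n : Type*} [Fintype n] [DecidableEq n]
    {W : Matrix n n ℝ} (hW : W ∈ Matrix.unitaryGroup n ℝ) :
    (Matrix.of fun i j => W i j ^ 2) ∈ doublyStochastic ℝ n := by
  refine mem_doublyStochastic_iff_sum.2 ⟨fun i j => sq_nonneg _, fun i => ?_, fun j => ?_⟩
  · have h := congrFun (congrFun (Matrix.mem_unitaryGroup_iff.1 hW) i) i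
    simpa [Matrix.mul_apply, sq] using h
  · have h := congrFun (congrFun (Matrix.mem_unitaryGroup_iff'.1 hW) j) j
    simpa [Matrix.mul_apply, sq] using h

theorem trace_mul_eq_sum_eigenvalues {n : Type*} [Fintype n] [DecidableEq n]
    {A B : Matrix n n ℝ} (hA : A.IsHermitian) (hB : B.IsHermitian) :
    (A * B).trace = ∑ i, ∑ j, hA.eigenvalues i *
      ((star (hA.eigenvectorUnitary : Matrix n n ℝ) * (hB.eigenvectorUnitary : Matrix n n ℝ)) i j) ^ 2
        * hB.eigenvalues j := by
  set UA := (hA.eigenvectorUnitary : Matrix n n ℝ) with hUA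
  set UB := (hB.eigenvectorUnitary : Matrix n n ℝ) with hUB
  have eA : A = UA * Matrix.diagonal hA.eigenvalues * star UA := by
    have := hA.spectral_theorem
    rwa [Unitary.conjStarAlgAut_apply] at this
  have eB : B = UB * Matrix.diagonal hB.eigenvalues * star UB := by
    have := hB.spectral_theorem
    rwa [Unitary.conjStarAlgAut_apply] at this
  have e : (A * B).trace = (Matrix.diagonal hA.eigenvalues * (star UA * UB) *
      (Matrix.diagonal hB.eigenvalues * star (star UA * UB))).trace := by
    conv_lhs => rw [eA, eB]
    rw [star_mul, star_star]
    simp only [Matrix.mul_assoc]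
    rw [Matrix.trace_mul_comm]
    simp only [Matrix.mul_assoc]
  rw [e, Matrix.trace]
  refine Finset.sum_congr rfl fun i _ => ?_
  rw [Matrix.diag_apply, Matrix.mul_apply]
  refine Finset.sum_congr rfl fun j _ => ?_
  rw [Matrix.diagonal_mul, Matrix.diagonal_mul, Matrix.star_apply, star_trivial (_ : ℝ)]
  ring

theorem trace_mul_self_eq_sum_sq_eigenvalues {n : Type*} [Fintype n] [DecidableEq n]
    {A : Matrix n n ℝ} (hA : A.IsHermitian) :
    (A * A).trace = ∑ i, hA.eigenvalues i ^ 2 := by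
  rw [trace_mul_eq_sum_eigenvalues hA hA]
  refine Finset.sum_congr rfl fun i _ => ?_
  rw [Unitary.coe_star_mul_self, Finset.sum_eq_single i]
  · simp; ring
  · intro j _ hj
    simp [Ne.symm hj]
  · simp

/-- `eigenvalues` need not be sorted along `n`, but both families are sorted lists pulled back along
the same bijection. -/
theorem monovary_eigenvalues {n : Type*} [Fintype n] [DecidableEq n]
    {A B : Matrix n n ℝ} (hA : A.IsHermitian) (hB : B.IsHermitian) :
    Monovary hA.eigenvalues hB.eigenvalues :=
  (hA.eigenvalues₀_antitone.monovary hB.eigenvalues₀_antitone).comp_right _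

/-- The **Hoffman–Wielandt inequality** for real symmetric matrices. -/
theorem hoffman_wielandt {p : ℕ} {A B : Matrix (Fin p) (Fin p) ℝ}
    (hA : A.IsHermitian) (hB : B.IsHermitian) :
    ∑ k, (sortedEigenvalue hA k - sortedEigenvalue hB k) ^ 2 ≤ ((A - B) * (A - B)).trace := by
  have h1 : ∑ k, (sortedEigenvalue hA k - sortedEigenvalue hB k) ^ 2
      = ∑ k, (hA.eigenvalues k - hB.eigenvalues k) ^ 2 := by
    let e : Fin p ≃ Fin p := (Fintype.equivOfCardEq (Fintype.card_fin _)).symm.trans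
      (finCongr (Fintype.card_fin p))
    exact (Equiv.sum_comp e _).symm
  -- After expanding the squares, only the cross term has to be compared.
  have h2 : (A * B).trace ≤ ∑ k, hA.eigenvalues k * hB.eigenvalues k := by
    rw [trace_mul_eq_sum_eigenvalues hA hB]
    exact sum_mul_mul_le_of_mem_doublyStochastic (monovary_eigenvalues hA hB)
      (sq_entries_mem_doublyStochastic
        (star hA.eigenvectorUnitary * hB.eigenvectorUnitary).2)
  have h3 : ((A - B) * (A - B)).trace = (A * A).trace + (B * B).trace - 2 * (A * B).trace := by
    rw [sub_mul, mul_sub, mul_sub, Matrix.trace_sub, Matrix.trace_sub, Matrix.trace_sub,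
      Matrix.trace_mul_comm B A]
    ring
  rw [h1, h3, trace_mul_self_eq_sum_sq_eigenvalues hA, trace_mul_self_eq_sum_sq_eigenvalues hB]
  simp only [sub_sq, Finset.sum_add_distrib, Finset.sum_sub_distrib, mul_assoc, ← Finset.mul_sum]
  linarith

/-! ### Replacing one observation: deterministic bound -/

theorem sampleCov_sub_sampleCov_replaceObs {n p : ℕ} (x : Fin n → EuclideanSpace ℝ (Fin p))
    (i : Fin n) (y : EuclideanSpace ℝ (Fin p)) :
    sampleCov x - sampleCov (replaceObs x i y) =
      (n : ℝ)⁻¹ • (Matrix.vecMulVec (x i).ofLp (x i).ofLp - Matrix.vecMulVec y.ofLp y.ofLp) := by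
  rw [sampleCov, sampleCov, ← smul_sub, ← Finset.sum_sub_distrib, Finset.sum_eq_single i]
  · simp [replaceObs]
  · intro j _ hj
    simp [replaceObs, Function.update_of_ne hj]
  · simp

theorem sq_norm_eq_dotProduct {p : ℕ} (x : EuclideanSpace ℝ (Fin p)) :
    ‖x‖ ^ 2 = x.ofLp ⬝ᵥ x.ofLp := by
  rw [EuclideanSpace.real_norm_sq_eq]
  simp only [dotProduct, sq]

/-- The trace equals `‖x‖⁴ + ‖y‖⁴ - 2⟨x, y⟩²`. -/
theorem trace_sq_vecMulVec_sub_le {p : ℕ} (x y : EuclideanSpace ℝ (Fin p)) :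
    ((Matrix.vecMulVec x.ofLp x.ofLp - Matrix.vecMulVec y.ofLp y.ofLp) *
      (Matrix.vecMulVec x.ofLp x.ofLp - Matrix.vecMulVec y.ofLp y.ofLp)).trace
      ≤ (‖x‖ ^ 2 + ‖y‖ ^ 2) ^ 2 := by
  have hx := sq_norm_eq_dotProduct x
  have hy := sq_norm_eq_dotProduct y
  have hxy : 0 ≤ (x.ofLp ⬝ᵥ x.ofLp) * (y.ofLp ⬝ᵥ y.ofLp) := by rw [← hx, ← hy]; positivity
  rw [hx, hy, sub_mul, mul_sub, mul_sub]
  simp only [Matrix.vecMulVec_mul_vecMulVec, Matrix.trace_sub, Matrix.trace_vecMulVec,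
    smul_eq_mul, Matrix.trace_smul, Matrix.vecMulVec_smul]
  rw [dotProduct_comm y.ofLp x.ofLp]
  nlinarith [sq_nonneg (x.ofLp ⬝ᵥ y.ofLp)]

theorem sum_sq_sortedEigenvalue_replaceObs_le {n p : ℕ} (x : Fin n → EuclideanSpace ℝ (Fin p))
    (i : Fin n) (y : EuclideanSpace ℝ (Fin p)) :
    ∑ k, (sortedEigenvalue (sampleCov_isHermitian x) k -
      sortedEigenvalue (sampleCov_isHermitian (replaceObs x i y)) k) ^ 2
      ≤ ((‖x i‖ ^ 2 + ‖y‖ ^ 2) / n) ^ 2 := by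
  refine (hoffman_wielandt _ _).trans ?_
  rw [sampleCov_sub_sampleCov_replaceObs, smul_mul_smul_comm, Matrix.trace_smul, smul_eq_mul,
    div_pow, div_eq_inv_mul, ← sq, inv_pow]
  exact mul_le_mul_of_nonneg_left (trace_sq_vecMulVec_sub_le _ _) (by positivity)

/-! ### Tails of Gaussian norms -/

theorem integrable_exp_sq_div_four_gaussianReal :
    Integrable (fun x : ℝ => Real.exp (x ^ 2 / 4)) (gaussianReal 0 1) := by
  rw [gaussianReal_of_var_ne_zero _ one_ne_zero, gaussianPDF_def,
    integrable_withDensity_iff_integrable_smul' (by fun_prop) (by simp)]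
  have h : Integrable fun x : ℝ => (√(2 * Real.pi))⁻¹ * Real.exp (-(1 / 4) * x ^ 2) :=
    (integrable_exp_neg_mul_sq (by norm_num)).const_mul _
  refine h.congr (Filter.Eventually.of_forall fun x => ?_)
  beta_reduce
  rw [ENNReal.toReal_ofReal (gaussianPDFReal_nonneg _ _ _)]
  simp only [gaussianPDFReal_def, smul_eq_mul,
    NNReal.coe_one, mul_one, sub_zero]
  rw [mul_assoc, ← Real.exp_add]
  congr 2
  ring

theorem integral_exp_sq_div_four_gaussianReal :
    ∫ x, Real.exp (x ^ 2 / 4) ∂(gaussianReal 0 1) = √2 := by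
  rw [integral_gaussianReal_eq_integral_smul one_ne_zero]
  have h (x : ℝ) : gaussianPDFReal 0 1 x • Real.exp (x ^ 2 / 4)
      = (√(2 * Real.pi))⁻¹ * Real.exp (-(1 / 4) * x ^ 2) := by
    simp only [gaussianPDFReal_def, smul_eq_mul, NNReal.coe_one, mul_one, sub_zero]
    rw [mul_assoc, ← Real.exp_add]
    congr 2
    ring
  simp_rw [h]
  rw [integral_const_mul, integral_gaussian, inv_mul_eq_div, ← Real.sqrt_div (by positivity)]
  congr 1
  field_simp
  norm_num

theorem sqrt_two_le_exp_one : √2 ≤ Real.exp 1 := by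
  have h : √2 ≤ 2 := by
    rw [Real.sqrt_le_left (by norm_num)]; norm_num
  linarith [Real.add_one_le_exp (1 : ℝ)]

/-- Chi-square tail bound: the squared norm of a standard Gaussian vector. -/
theorem stdGaussian_sq_norm_tail (d : ℕ) (s : ℝ) :
    (stdGaussian (EuclideanSpace ℝ (Fin d))).real {z | 4 * (s + d) ≤ ‖z‖ ^ 2} ≤ Real.exp (-s) := by
  rw [← map_pi_eq_stdGaussian, map_measureReal_apply (by fun_prop)
    (measurableSet_le (by fun_prop) (by fun_prop))]
  set μ := Measure.pi (fun _ : Fin d => gaussianReal 0 1)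
  have he (x : Fin d → ℝ) : Real.exp (1 / 4 * ‖(WithLp.toLp 2 x : EuclideanSpace ℝ (Fin d))‖ ^ 2)
      = ∏ i, Real.exp (x i ^ 2 / 4) := by
    rw [← Real.exp_sum, EuclideanSpace.real_norm_sq_eq, Finset.mul_sum]
    congr 1
    exact Finset.sum_congr rfl fun i _ => by simp; ring
  have hint : Integrable (fun x : Fin d → ℝ =>
      Real.exp (1 / 4 * ‖(WithLp.toLp 2 x : EuclideanSpace ℝ (Fin d))‖ ^ 2)) μ := by
    simp_rw [he]
    exact Integrable.fintype_prod (fun _ => integrable_exp_sq_div_four_gaussianReal)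
  have hmgf : mgf (fun x : Fin d → ℝ => ‖(WithLp.toLp 2 x : EuclideanSpace ℝ (Fin d))‖ ^ 2) μ (1 / 4)
      = √2 ^ d := by
    rw [mgf]
    simp_rw [he]
    rw [integral_fintype_prod_eq_prod (f := fun _ x => Real.exp (x ^ 2 / 4))]
    simp [integral_exp_sq_div_four_gaussianReal]
  -- Chernoff at parameter `1/4`: the shift `4 * d` in the threshold pays for the moment factor `√2
  -- ^ d ≤ e ^ d`.
  refine (measure_ge_le_exp_mul_mgf (4 * (s + d)) (by norm_num) hint).trans ?_
  rw [hmgf]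
  calc Real.exp (-(1 / 4) * (4 * (s + d))) * √2 ^ d
      ≤ Real.exp (-(1 / 4) * (4 * (s + d))) * Real.exp 1 ^ d := by
        gcongr
        exact sqrt_two_le_exp_one
    _ = Real.exp (-s) := by
        rw [← Real.exp_nat_mul, ← Real.exp_add]
        congr 1
        ring

/-- The characteristic function of a standard Gaussian depends only on the norm of its argument, and
`t ↦ U t` is an isometry. -/
theorem stdGaussian_map_transpose {p r : ℕ} {U : Matrix (Fin p) (Fin r) ℝ}
    (hU : U.transpose * U = 1) :
    (stdGaussian (EuclideanSpace ℝ (Fin p))).map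
      (fun z => WithLp.toLp 2 (U.transpose.mulVec z.ofLp)) = stdGaussian (EuclideanSpace ℝ (Fin r)) := by
  have hm : Continuous fun z : EuclideanSpace ℝ (Fin p) =>
      (WithLp.toLp 2 (U.transpose.mulVec z.ofLp) : EuclideanSpace ℝ (Fin r)) := by
    have := (PiLp.continuous_toLp 2 (fun _ : Fin r => ℝ))
    refine this.comp (Continuous.matrix_mulVec continuous_const ?_)
    exact PiLp.continuous_ofLp 2 _
  have := Measure.isProbabilityMeasure_map (μ := stdGaussian (EuclideanSpace ℝ (Fin p)))
    hm.aemeasurable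
  apply Measure.ext_of_charFun
  ext t
  have hin (z : EuclideanSpace ℝ (Fin p)) :
      inner ℝ (WithLp.toLp 2 (U.transpose.mulVec z.ofLp) : EuclideanSpace ℝ (Fin r)) t
        = inner ℝ z (WithLp.toLp 2 (U.mulVec t.ofLp)) := by
    simp only [EuclideanSpace.inner_eq_star_dotProduct, star_trivial]
    rw [dotProduct_comm, Matrix.mulVec_transpose, ← Matrix.dotProduct_mulVec, dotProduct_comm]
  have hn : ‖(WithLp.toLp 2 (U.mulVec t.ofLp) : EuclideanSpace ℝ (Fin p))‖ = ‖t‖ := by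
    rw [← sq_eq_sq₀ (norm_nonneg _) (norm_nonneg _), ← real_inner_self_eq_norm_sq, ← hin]
    rw [Matrix.mulVec_mulVec, hU, Matrix.one_mulVec, ← real_inner_self_eq_norm_sq]
  rw [charFun_apply, integral_map hm.aemeasurable (by fun_prop)]
  simp_rw [hin]
  rw [← charFun_apply, charFun_stdGaussian, charFun_stdGaussian, hn]

theorem posSemidef_of_mem_spikedCovariances {c₀ C₀ : ℝ} {p r : ℕ} {lam s2 : ℝ} (hc : 0 ≤ c₀ * lam)
    (hs : 0 ≤ s2) {S : Matrix (Fin p) (Fin p) ℝ} (hS : S ∈ spikedCovariances c₀ C₀ p r lam s2) :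
    S.PosSemidef := by
  obtain ⟨U, ℓ, -, -, hℓ, rfl⟩ := hS
  refine Matrix.PosSemidef.add ?_ (Matrix.PosSemidef.one.smul hs)
  have h := (Matrix.PosSemidef.diagonal (d := ℓ)
    (fun k => hc.trans (hℓ k).1)).mul_mul_conjTranspose_same U
  rwa [Matrix.conjTranspose_eq_transpose_of_trivial] at h

open scoped MatrixOrder in
theorem sq_norm_toEuclideanCLM_sqrt {p : ℕ} {S : Matrix (Fin p) (Fin p) ℝ} (hS : S.PosSemidef)
    (z : EuclideanSpace ℝ (Fin p)) :
    ‖Matrix.toEuclideanCLM (𝕜 := ℝ) (CFC.sqrt S) z‖ ^ 2 = z.ofLp ⬝ᵥ S.mulVec z.ofLp := by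
  have hsa : IsSelfAdjoint (Matrix.toEuclideanCLM (n := Fin p) (𝕜 := ℝ) (CFC.sqrt S)) :=
    (CFC.sqrt_nonneg S).isSelfAdjoint.map _
  rw [← real_inner_self_eq_norm_sq, ← ContinuousLinearMap.adjoint_inner_right, hsa.adjoint_eq,
    ← ContinuousLinearMap.comp_apply, ← ContinuousLinearMap.mul_def, ← map_mul,
    CFC.sqrt_mul_sqrt_self _ hS.nonneg, Matrix.inner_toEuclideanCLM]

theorem dotProduct_mulVec_spiked_le {p r : ℕ} (U : Matrix (Fin p) (Fin r) ℝ) {ℓ : Fin r → ℝ}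
    {L : ℝ} (hℓ : ∀ k, ℓ k ≤ L) (s2 : ℝ) (z : EuclideanSpace ℝ (Fin p)) :
    z.ofLp ⬝ᵥ (U * Matrix.diagonal ℓ * U.transpose +
        s2 • (1 : Matrix (Fin p) (Fin p) ℝ)).mulVec z.ofLp
      ≤ L * ‖(WithLp.toLp 2 (U.transpose.mulVec z.ofLp) : EuclideanSpace ℝ (Fin r))‖ ^ 2
        + s2 * ‖z‖ ^ 2 := by
  rw [Matrix.add_mulVec, dotProduct_add, Matrix.smul_mulVec, Matrix.one_mulVec, dotProduct_smul,
    smul_eq_mul]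
  rw [sq_norm_eq_dotProduct z, ← Matrix.mulVec_mulVec, ← Matrix.mulVec_mulVec, Matrix.dotProduct_mulVec,
    ← Matrix.mulVec_transpose, EuclideanSpace.real_norm_sq_eq, Finset.mul_sum]
  gcongr
  rw [dotProduct]
  refine Finset.sum_le_sum fun k _ => ?_
  rw [Matrix.mulVec_diagonal]
  nlinarith [mul_le_mul_of_nonneg_right (hℓ k) (sq_nonneg (U.transpose.mulVec z.ofLp k))]

theorem multivariateGaussian_spiked_sq_norm_tail {c₀ C₀ : ℝ} {p r : ℕ} {lam s2 : ℝ}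
    (hc : 0 < c₀) (hlam : 0 < lam) (hC : 0 < C₀) (hs2 : 0 < s2)
    {S : Matrix (Fin p) (Fin p) ℝ} (hS : S ∈ spikedCovariances c₀ C₀ p r lam s2) (s : ℝ) :
    (multivariateGaussian 0 S).real
      {x | C₀ * lam * (4 * (s + r)) + s2 * (4 * (s + p)) ≤ ‖x‖ ^ 2} ≤ 2 * Real.exp (-s) := by
  have hpsd := posSemidef_of_mem_spikedCovariances (mul_pos hc hlam).le hs2.le hS
  obtain ⟨U, ℓ, hU, -, hℓ, rfl⟩ := hS
  rw [multivariateGaussian, map_measureReal_apply (by fun_prop)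
    (measurableSet_le (by fun_prop) (by fun_prop))]
  set G := stdGaussian (EuclideanSpace ℝ (Fin p))
  have hm : Measurable fun z : EuclideanSpace ℝ (Fin p) =>
      (WithLp.toLp 2 (U.transpose.mulVec z.ofLp) : EuclideanSpace ℝ (Fin r)) :=
    ((PiLp.continuous_toLp 2 (fun _ : Fin r => ℝ)).comp
      (Continuous.matrix_mulVec continuous_const (PiLp.continuous_ofLp 2 _))).measurable
  have h1 : G.real {z | 4 * (s + r) ≤
      ‖(WithLp.toLp 2 (U.transpose.mulVec z.ofLp) : EuclideanSpace ℝ (Fin r))‖ ^ 2}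
      ≤ Real.exp (-s) := by
    have := stdGaussian_sq_norm_tail r s
    rwa [← stdGaussian_map_transpose hU, map_measureReal_apply hm
      (measurableSet_le (by fun_prop) (by fun_prop))] at this
  have h2 : G.real {z | 4 * (s + p) ≤ ‖z‖ ^ 2} ≤ Real.exp (-s) := stdGaussian_sq_norm_tail p s
  refine (measureReal_mono (s₂ := {z | 4 * (s + r) ≤
      ‖(WithLp.toLp 2 (U.transpose.mulVec z.ofLp) : EuclideanSpace ℝ (Fin r))‖ ^ 2} ∪
      {z | 4 * (s + p) ≤ ‖z‖ ^ 2}) ?_).trans ((measureReal_union_le _ _).trans (by linarith))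
  intro z hz
  simp only [Set.mem_preimage, Set.mem_ofPred_eq, zero_add, Set.mem_union] at hz ⊢
  -- If both chi-square variables stay below their thresholds, so does the quadratic form `zᵀ S z`.
  by_contra! hcon
  have hle := dotProduct_mulVec_spiked_le U (fun k => (hℓ k).2) s2 z
  rw [sq_norm_toEuclideanCLM_sqrt hpsd] at hz
  have e1 := mul_lt_mul_of_pos_left hcon.1 (mul_pos hC hlam)
  have e2 := mul_lt_mul_of_pos_left hcon.2 hs2
  linarith

theorem ProbabilityTheory.HasLaw.measureReal_preimage {Ω E : Type*} [MeasurableSpace Ω] [MeasurableSpace E]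
    {P : Measure Ω} {μ : Measure E} {X : Ω → E} (hX : HasLaw X μ P) {s : Set E}
    (hs : MeasurableSet s) : P.real (X ⁻¹' s) = μ.real s := by
  rw [← hX.map_eq, measureReal_def, measureReal_def, Measure.map_apply_of_aemeasurable
    hX.aemeasurable hs]

/-! ### Union bound and conclusion -/

theorem four_mul_exp_neg_log_le {n : ℕ} (hn : 2 ≤ n) :
    n * (4 * Real.exp (-(103 * Real.log n))) ≤ 1 / (n : ℝ) ^ 100 := by
  have hn' : (2 : ℝ) ≤ n := by exact_mod_cast hn
  have hn0 : (0 : ℝ) < n := by linarith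
  have e : Real.exp (-(103 * Real.log n)) = ((n : ℝ) ^ 103)⁻¹ := by
    rw [Real.exp_neg, show (103 : ℝ) * Real.log n = Real.log ((n : ℝ) ^ 103) by
      rw [Real.log_pow]; norm_num, Real.exp_log (by positivity)]
  rw [e, show (n : ℝ) * (4 * ((n : ℝ) ^ 103)⁻¹) = 4 / (n : ℝ) ^ 2 * (1 / (n : ℝ) ^ 100) by
    field_simp]
  refine mul_le_of_le_one_left (by positivity) ?_
  rw [div_le_one (by positivity)]
  nlinarith

theorem mainTheorem9 (c₀ C₀ C₁ : ℝ) (hc₀ : 0 < c₀) (hC₀ : c₀ ≤ C₀) (hC₁ : 0 < C₁) :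
    ∃ C₂ : ℝ, 0 < C₂ ∧
      ∀ (n p r : ℕ) (lam σ : ℝ), 1 ≤ n → 1 ≤ r → 2 * r ≤ p → 0 < lam → 0 < σ →
        C₁ * (r * Real.log n + Real.log n ^ 2) ≤ n →
        C₁ * ((p : ℝ) / n + Real.sqrt ((p : ℝ) / n)) ≤ lam / σ ^ 2 →
      ∀ S ∈ spikedCovariances c₀ C₀ p r lam (σ ^ 2),
      ∀ (Ω : Type*) [MeasurableSpace Ω] (P : Measure Ω) [IsProbabilityMeasure P]
        (X X' : Fin n → Ω → EuclideanSpace ℝ (Fin p)),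
        (∀ i, HasLaw (X i) (multivariateGaussian 0 S) P) →
        (∀ i, HasLaw (X' i) (multivariateGaussian 0 S) P) →
        iIndepFun X P →
        (∀ i, IndepFun (X' i) (fun ω j => X j ω) P) →
        1 - 1 / (n : ℝ) ^ 100 ≤ P.real {ω | ∀ i : Fin n,
          ∑ k : Fin p,
            (sortedEigenvalue (sampleCov_isHermitian (fun j => X j ω)) k -
              sortedEigenvalue
                (sampleCov_isHermitian (replaceObs (fun j => X j ω) i (X' i ω))) k) ^ 2
          ≤ C₂ * ((lam * (r + Real.log n) + σ ^ 2 * (p + Real.log n)) / n) ^ 2} := by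
  have hC : 0 < C₀ := hc₀.trans_le hC₀
  -- `824 = 2 * 4 * 103`: two vectors, the chi-square factor and the level `s`; `C₀ + 1` dominates
  -- the coefficients of both the spike and the noise terms.
  refine ⟨(824 * (C₀ + 1)) ^ 2, by positivity, ?_⟩
  intro n p r lam σ hn _ _ hlam hσ _ _ S hS Ω _ P _ X X' hX hX' _ _
  -- For `n = 1` the required probability is `0`.
  rcases hn.eq_or_lt with rfl | hn2
  · simp
  have hlog : 0 ≤ Real.log n := Real.log_natCast_nonneg n
  -- The failure probability is at most `4 n · n⁻¹⁰³`, and `4 ≤ n ^ 2` absorbs the constant.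
  set s : ℝ := 103 * Real.log n with hs
  set bound : ℝ := C₀ * lam * (4 * (s + r)) + σ ^ 2 * (4 * (s + p)) with hbound
  set T : Set (EuclideanSpace ℝ (Fin p)) := {x | bound ≤ ‖x‖ ^ 2} with hT
  have hTm : MeasurableSet T := measurableSet_le (by fun_prop) (by fun_prop)
  have htail : (multivariateGaussian 0 S).real T ≤ 2 * Real.exp (-s) :=
    multivariateGaussian_spiked_sq_norm_tail hc₀ hlam hC (by positivity) hS s
  have hbound_le : 2 * bound ≤
      824 * (C₀ + 1) * (lam * (r + Real.log n) + σ ^ 2 * (p + Real.log n)) := by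
    have h1 : 0 ≤ lam * Real.log n := by positivity
    have h2 : 0 ≤ lam * r := by positivity
    have h3 : 0 ≤ σ ^ 2 * Real.log n := by positivity
    have h4 : 0 ≤ σ ^ 2 * p := by positivity
    have h5 := mul_nonneg hC.le h2
    have h6 := mul_nonneg hC.le h3
    have h7 := mul_nonneg hC.le h4
    rw [hbound, hs]
    linarith
  have hbad : P.real (⋃ i, (X i ⁻¹' T ∪ X' i ⁻¹' T)) ≤ 1 / (n : ℝ) ^ 100 := by
    refine (measureReal_iUnion_fintype_le _).trans
      (le_trans ?_ (four_mul_exp_neg_log_le (Nat.succ_le_of_lt hn2)))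
    calc ∑ i, P.real (X i ⁻¹' T ∪ X' i ⁻¹' T) ≤ ∑ _i : Fin n, 4 * Real.exp (-s) := by
          refine Finset.sum_le_sum fun i _ => (measureReal_union_le _ _).trans ?_
          rw [(hX i).measureReal_preimage hTm, (hX' i).measureReal_preimage hTm]
          linarith
      _ = n * (4 * Real.exp (-s)) := by simp
  set good : Set Ω := {ω | ∀ i : Fin n, _} with hgood
  have hcover : (Set.univ : Set Ω) ⊆ good ∪ ⋃ i, (X i ⁻¹' T ∪ X' i ⁻¹' T) := by
    intro ω _
    by_cases hω : ω ∈ ⋃ i, (X i ⁻¹' T ∪ X' i ⁻¹' T)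
    · exact Or.inr hω
    refine Or.inl fun i => ?_
    simp only [Set.mem_iUnion, Set.mem_union, Set.mem_preimage, not_exists, not_or] at hω
    obtain ⟨h1, h2⟩ := hω i
    replace h1 : ‖X i ω‖ ^ 2 < bound := not_le.1 h1
    replace h2 : ‖X' i ω‖ ^ 2 < bound := not_le.1 h2
    refine (sum_sq_sortedEigenvalue_replaceObs_le (fun j => X j ω) i (X' i ω)).trans ?_
    rw [← mul_pow, ← mul_div_assoc]
    gcongr
    linarith
  have h1 : (1 : ℝ) ≤ P.real good + P.real (⋃ i, (X i ⁻¹' T ∪ X' i ⁻¹' T)) := by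
    rw [← probReal_univ (μ := P)]
    exact (measureReal_mono hcover).trans (measureReal_union_le _ _)
  linarith
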